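/- **Theorem 9.** All objects are real and smooth. Let $E\to M$ be a vector bundle of finite rank over a smooth manifold and let $(E,E^*)$ be a Lie bialgebroid: $E$ and $E^*$ carry Lie algebroid structures with brackets $[\cdot,\cdot]_E$, $[\cdot,\cdot]_{E^*}$, anchors $a$, $a_*$, differentials $d_E$, $d_{E^*}$ and Lie derivatives $\mathcal L^E,\mathcal L^{E^*}$ (the indices are often suppressed), and $d_{E^*}[X,Y]=[d_{E^*}X,Y]+[X,d_{E^*}Y]$ (Schouten brackets) for $X,Y\in\mathrm{Sec}(E)$. On sections of $A=E\oplus E^*$ consider the pairing $\langle X+\xi,Y+\eta\rangle=\langle\xi,Y\rangle+\langle\eta,X\rangle$ and the Courant product $$(X+\xi)\circ(Y+\eta)=\big([X,Y]+\mathcal L_\xi Y-i_\eta d_{E^*}X\big)+\big([\xi,\eta]+\mathcal L_X\eta-i_Yd_E\xi\big).$$ For a binary operation $\circ$ and a map $N$ put $X\circ_NY=NX\circ Y+X\circ NY-N(X\circ Y)$ and $T_N(X,Y)=NX\circ NY-N(X\circ_NY)$. A $(1,1)$-tensor $N:A\to A$ gives a *Lie bialgebroid-Nijenhuis structure* $(E,E^*,N)$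 if $N+N^*=\lambda I$ for some $\lambda\in\mathbb R$, where $N^*$ is the adjoint with respect to the pairing of $A$, and if for $L=E$ and for $L=E^*$ the sections of $L$ are closed under $\circ_N$ and $T_N(s,t)=0$ for all $s,t\in\mathrm{Sec}(L)$. Let $$N=\begin{pmatrix}N_E&\Lambda\\ \Omega&N_{E^*}\end{pmatrix},\qquad N_E:E\to E,\quad \Lambda:E^*\to E,\quad \Omega:E\to E^*,\quad N_{E^*}:E^*\to E^*$$ be vector bundle maps. For arbitrary (not necessarily skew-symmetric) vector bundle maps $K:E\to E^*$ and $Q:E^*\to E$ put $$[X,Y]^K=\mathcal L_{KX}Y-\mathcal L_{KY}X+d_{E^*}\langle X,KY\rangle,\qquad d_EK(X,Y,\cdot)=\mathcal L_X(KY)-i_Yd_E(KX)-K[X,Y]_E,$$ $$[\eta,\xi]^Q=\mathcal L_{Q\eta}\xi-\mathcal L_{Q\xi}\eta+d_E\langle \eta,Q\xi\rangle,\qquad d_{E^*}Q(\eta,\xi,\cdot)=\mathcal L_\eta(Q\xi)-i_\xi d_{E^*}(Q\eta)-Q[\eta,\xi]_{E^*}.$$ Then $N$ gives a Lie bialgebroid-Nijenhuis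 structure $(E,E^*,N)$ if and only if the following three conditions hold. 1. $N_E+{}^tN_{E^*}=\lambda I_E$ for some $\lambda\in\mathbb R$. 2. $\Omega$ and $\Lambda$ are skew-symmetric and closed: $d_E\Omega=0$ and $d_{E^*}\Lambda=0$. 3. For all $X,Y\in\mathrm{Sec}(E)$ and $\eta,\xi\in\mathrm{Sec}(E^*)$, $$T_{N_E}(X,Y)+[X,Y]^{\Omega}_{N_E}-[X,Y]^{\Omega N_E}=0,$$ $$[\Omega X,\Omega Y]_{E^*}-\Omega([X,Y]^\Omega)-d_E(\Omega N_E)(X,Y,\cdot)=0,$$ $$T_{N_{E^*}}(\eta,\xi)+[\eta,\xi]^{\Lambda}_{N_{E^*}}-[\eta,\xi]^{\Lambda N_{E^*}}=0,$$ $$[\Lambda\eta,\Lambda\xi]_E-\Lambda([\eta,\xi]^\Lambda)-d_{E^*}(\Lambda N_{E^*})(\eta,\xi,\cdot)=0.$$ Here $T_{N_E}$ and $T_{N_{E^*}}$ are the torsions for $[\cdot,\cdot]_E$ and $[\cdot,\cdot]_{E^*}$, and $[\cdot,\cdot]^\Omega_{N_E}$, $[\cdot,\cdot]^\Lambda_{N_{E^*}}$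 are the contractions of $[\cdot,\cdot]^\Omega$ by $N_E$ and of $[\cdot,\cdot]^\Lambda$ by $N_{E^*}$. -/

import Mathlib

open Bundle Function
open scoped Manifold ContDiff Topology

noncomputable section

namespace LieBialg

/-! ### Smooth functions and smooth sections -/

/-- The ring `C^∞(M)` of smooth real functions on an `m`-dimensional manifold `M`. -/
abbrev Fun (m : ℕ) (M : Type*) [TopologicalSpace M] [ChartedSpace (EuclideanSpace ℝ (Fin m)) M] :
    Type _ :=
  C^∞⟮𝓡 m, M; ℝ⟯

/-- The space `Sec(V)` of smooth sections of a bundle `V` with typical fibre `F`. -/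
abbrev Sec (m : ℕ) (F : Type*) [NormedAddCommGroup F] [NormedSpace ℝ F]
    {M : Type*} [TopologicalSpace M] [ChartedSpace (EuclideanSpace ℝ (Fin m)) M]
    (V : M → Type*) [TopologicalSpace (TotalSpace F V)] [∀ x, TopologicalSpace (V x)]
    [FiberBundle F V] : Type _ :=
  Cₛ^∞⟮𝓡 m; F, V⟯

section General

variable {m : ℕ} {M : Type*} [TopologicalSpace M] [ChartedSpace (EuclideanSpace ℝ (Fin m)) M]
  {F : Type*} [NormedAddCommGroup F] [NormedSpace ℝ F]
  {V : M → Type*} [TopologicalSpace (TotalSpace F V)] [∀ x, TopologicalSpace (V x)]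
  [∀ x, AddCommGroup (V x)] [∀ x, Module ℝ (V x)] [FiberBundle F V] [VectorBundle ℝ F V]
  {G : Type*} [NormedAddCommGroup G] [NormedSpace ℝ G]
  {W : M → Type*} [TopologicalSpace (TotalSpace G W)] [∀ x, TopologicalSpace (W x)]
  [∀ x, AddCommGroup (W x)] [∀ x, Module ℝ (W x)] [FiberBundle G W] [VectorBundle ℝ G W]

/-- Multiplication of sections by functions. -/
instance Sec.instSMulFun : SMul (Fun m M) (Sec m F V) :=
  ⟨fun f s => ⟨fun x => f x • s x, f.contMDiff.smul_section s.contMDiff⟩⟩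

theorem Sec.fun_smul_apply (f : Fun m M) (s : Sec m F V) (x : M) : (f • s) x = f x • s x := rfl

/-- `Sec(V)` is a module over `C^∞(M)`. -/
instance Sec.instModuleFun : Module (Fun m M) (Sec m F V) where
  one_smul s := ContMDiffSection.ext fun x => one_smul ℝ (s x)
  mul_smul f g s := ContMDiffSection.ext fun x => mul_smul (f x) (g x) (s x)
  smul_zero f := ContMDiffSection.ext fun x => smul_zero (f x)
  smul_add f s t := ContMDiffSection.ext fun x => smul_add (f x) (s x) (t x)
  add_smul f g s := ContMDiffSection.ext fun x => add_smul (f x) (g x) (s x)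
  zero_smul s := ContMDiffSection.ext fun x => zero_smul ℝ (s x)

theorem Sec.sum_apply {ι : Type*} (t : Finset ι) (s : ι → Sec m F V) (x : M) :
    (∑ i ∈ t, s i) x = ∑ i ∈ t, s i x := by
  classical
  induction t using Finset.induction_on with
  | empty => simp
  | insert a t ha ih => rw [Finset.sum_insert ha, Finset.sum_insert ha, ← ih]; rfl

theorem Fun.sum_apply {ι : Type*} (t : Finset ι) (s : ι → Fun m M) (x : M) :
    (∑ i ∈ t, s i) x = ∑ i ∈ t, s i x := by
  classical
  induction t using Finset.induction_on with
  | empty => simp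
  | insert a t ha ih => rw [Finset.sum_insert ha, Finset.sum_insert ha, ← ih]; rfl

/-! ### Perfect pairings of section modules

A `C^∞(M)`-bilinear pairing of `Sec(V)` and `Sec(W)` which locally admits dual frames is perfect.
-/

/-- The pairing `p` is pointwise, and around every point there are sections of `V` and of `W` which,
up to a cut-off function, are dual frames for `p`. -/
def HasDualFrames (p : Sec m F V →ₗ[Fun m M] Sec m G W →ₗ[Fun m M] Fun m M) : Prop :=
  (∀ X ξ x, (X x = 0 ∨ ξ x = 0) → p X ξ x = 0) ∧ ∀ x : M, ∃ (n : ℕ) (v : Fin n → Sec m F V) (w : Fin n → Sec m G W) (χ : Fun m M),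
    (∀ᶠ y in 𝓝 x, χ y = 1) ∧ (∀ X, χ • X = ∑ i, p X (w i) • v i) ∧
      (∀ ξ, χ • ξ = ∑ i, p (v i) ξ • w i)

theorem HasDualFrames.flip {p : Sec m F V →ₗ[Fun m M] Sec m G W →ₗ[Fun m M] Fun m M}
    (h : HasDualFrames p) : HasDualFrames p.flip := by
  refine ⟨fun X ξ x hx => h.1 ξ X x hx.symm, fun x => ?_⟩
  obtain ⟨n, v, w, χ, h1, h2, h3⟩ := h.2 x
  exact ⟨n, w, v, χ, h1, h3, h2⟩

theorem HasDualFrames.apply_eq_zero {p : Sec m F V →ₗ[Fun m M] Sec m G W →ₗ[Fun m M] Fun m M}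
    (h : HasDualFrames p) {ξ : Sec m G W} {x : M} (hξ : ∀ X, p X ξ x = 0) : ξ x = 0 := by
  obtain ⟨n, v, w, χ, h1, h2, h3⟩ := h.2 x
  have h4 : (χ • ξ) x = (∑ i, p (v i) ξ • w i) x := by rw [h3 ξ]
  rw [Sec.fun_smul_apply, h1.self_of_nhds, one_smul, Sec.sum_apply] at h4
  rw [h4]
  exact Finset.sum_eq_zero fun i _ => by rw [Sec.fun_smul_apply, hξ, zero_smul]

theorem HasDualFrames.bijective_flip {p : Sec m F V →ₗ[Fun m M] Sec m G W →ₗ[Fun m M] Fun m M}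
    (h : HasDualFrames p) : Bijective p.flip := by
  constructor
  · rw [injective_iff_map_eq_zero]
    intro ξ hξ
    refine ContMDiffSection.ext fun x => h.apply_eq_zero fun X => ?_
    have h1 : p.flip ξ X = 0 := by rw [hξ]; rfl
    exact DFunLike.congr_fun h1 x
  · intro Φ
    choose n v w χ h1 h2 h3 using h.2
    have key : ∀ x y X, p X (∑ i, Φ (v x i) • w x i) y = χ x y * Φ X y := by
      intro x y X
      have h4 : p X (∑ i, Φ (v x i) • w x i) = χ x • Φ X := by
        rw [← map_smul, h2 x X, map_sum, map_sum]
        refine Finset.sum_congr rfl fun i _ => ?_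
        rw [map_smul, map_smul, smul_eq_mul, smul_eq_mul, mul_comm]
      rw [h4]; rfl
    have loc : ∀ x y, χ x y = 1 →
        (∑ i, Φ (v y i) • w y i) y = (∑ i, Φ (v x i) • w x i) y := by
      intro x y hxy
      rw [← sub_eq_zero]
      refine HasDualFrames.apply_eq_zero (p := p)
        (ξ := ∑ i, Φ (v y i) • w y i - ∑ i, Φ (v x i) • w x i)
        (⟨h.1, fun x => ⟨n x, v x, w x, χ x, h1 x, h2 x, h3 x⟩⟩) fun X => ?_
      have h5 := key x y X
      have h6 := key y y X
      rw [hxy] at h5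
      rw [(h1 y).self_of_nhds] at h6
      rw [map_sub]
      change p X _ y - p X _ y = 0
      rw [h5, h6, sub_self]
    let ξ : Sec m G W := ⟨fun x => (∑ i, Φ (v x i) • w x i) x, fun x => by
      refine ((∑ i, Φ (v x i) • w x i).contMDiff x).congr_of_eventuallyEq ?_
      filter_upwards [h1 x] with y hy
      rw [loc x y hy]⟩
    refine ⟨ξ, LinearMap.ext fun X => ContMDiffMap.ext fun x => ?_⟩
    have h7 : p X (ξ - ∑ i, Φ (v x i) • w x i) x = 0 := h.1 _ _ _ (Or.inr (sub_self _))
    rw [map_sub] at h7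
    have h8 : p X ξ x - p X (∑ i, Φ (v x i) • w x i) x = 0 := h7
    rw [key, (h1 x).self_of_nhds, one_mul, sub_eq_zero] at h8
    exact h8

/-! ### The pairing of a bundle with its dual bundle -/

/-- A perfect pairing from dual frames. -/
theorem HasDualFrames.isPerfPair {p : Sec m F V →ₗ[Fun m M] Sec m G W →ₗ[Fun m M] Fun m M}
    (h : HasDualFrames p) : p.IsPerfPair :=
  ⟨h.flip.bijective_flip, h.bijective_flip⟩

theorem Fun.mdifferentiableAt (f : Fun m M) (x : M) : MDifferentiableAt (𝓡 m) 𝓘(ℝ, ℝ) f x :=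
  f.contMDiff.mdifferentiable (by simp) x

/-- The section of `W` which represents a linear form on `Sec(V)`. -/
def represent (p : Sec m F V →ₗ[Fun m M] Sec m G W →ₗ[Fun m M] Fun m M) [p.IsPerfPair]
    (Φ : Sec m F V →ₗ[Fun m M] Fun m M) : Sec m G W := p.flip.toPerfPair.symm Φ

theorem represent_spec (p : Sec m F V →ₗ[Fun m M] Sec m G W →ₗ[Fun m M] Fun m M)
    [p.IsPerfPair] (Φ : Sec m F V →ₗ[Fun m M] Fun m M) (X : Sec m F V) :
    p X (represent p Φ) = Φ X := p.apply_toPerfPair_flip Φ X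

end General

/-- The dual bundle `E*`, with fibres `E x →L[ℝ] ℝ`. -/
abbrev DualBundle {M : Type*} (E : M → Type*) [∀ x, TopologicalSpace (E x)]
    [∀ x, AddCommGroup (E x)] [∀ x, Module ℝ (E x)] : M → Type _ :=
  fun x => E x →L[ℝ] Bundle.Trivial M ℝ x

section Dual

variable {m : ℕ} {M : Type*} [TopologicalSpace M] [ChartedSpace (EuclideanSpace ℝ (Fin m)) M]
  {F : Type*} [NormedAddCommGroup F] [NormedSpace ℝ F]
  {E : M → Type*} [TopologicalSpace (TotalSpace F E)] [∀ x, TopologicalSpace (E x)]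
  [∀ x, AddCommGroup (E x)] [∀ x, Module ℝ (E x)] [FiberBundle F E] [VectorBundle ℝ F E]

/-- The function `⟨X, ξ⟩` for `X ∈ Sec(E)` and `ξ ∈ Sec(E*)`. -/
def evalFun (X : Sec m F E) (ξ : Sec m (F →L[ℝ] ℝ) (DualBundle E)) : Fun m M :=
  ⟨fun x => ξ x (X x), by
    have h := ContMDiff.clm_bundle_apply ξ.contMDiff X.contMDiff
    intro x
    exact ((contMDiffAt_totalSpace.1 (h x)).2)⟩

variable (m F E) in
/-- The `C^∞(M)`-bilinear pairing `⟨X, ξ⟩` of `Sec(E)` and `Sec(E*)`. -/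
def pairing : Sec m F E →ₗ[Fun m M] Sec m (F →L[ℝ] ℝ) (DualBundle E) →ₗ[Fun m M] Fun m M :=
  LinearMap.mk₂ (Fun m M) evalFun
    (fun X Y ξ => ContMDiffMap.ext fun x => map_add (ξ x) (X x) (Y x))
    (fun f X ξ => ContMDiffMap.ext fun x => map_smul (ξ x) (f x) (X x))
    (fun _ _ _ => rfl)
    (fun _ _ _ => rfl)

theorem pairing_apply (X : Sec m F E) (ξ : Sec m (F →L[ℝ] ℝ) (DualBundle E)) (x : M) :
    pairing m F E X ξ x = ξ x (X x) := rfl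

theorem hasDualFrames_pairing [T2Space M] [IsManifold (𝓡 m) ∞ M] [FiniteDimensional ℝ F]
    [ContMDiffVectorBundle ∞ F E (𝓡 m)] : HasDualFrames (pairing m F E) := by
  refine ⟨fun X ξ x hx => ?_, fun x => ?_⟩
  · rw [pairing_apply]
    rcases hx with hx | hx
    · rw [hx]; exact map_zero (ξ x)
    · rw [hx]; rfl
  · let e := trivializationAt F E x
    let b := Module.finBasis ℝ F
    have hx : x ∈ e.baseSet := mem_baseSet_trivializationAt F E x
    obtain ⟨ψ, hψ⟩ := (SmoothBumpFunction.nhds_basis_support (I := 𝓡 m)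
      (e.open_baseSet.mem_nhds hx)).ex_mem
    let ε : Fin (Module.finrank ℝ F) → (y : M) → DualBundle E y := fun i y =>
      (LinearMap.toContinuousLinearMap (b.coord i)).comp (e.continuousLinearMapAt ℝ y)
    have hε : ∀ i, ContMDiffOn (𝓡 m) ((𝓡 m).prod 𝓘(ℝ, F →L[ℝ] ℝ)) ∞
        (fun y => TotalSpace.mk' (F →L[ℝ] ℝ) y (ε i y)) e.baseSet := by
      intro i
      have h := (trivializationAt (F →L[ℝ] ℝ) (DualBundle E) x).contMDiffOn_section_baseSet_iff
        (IB := 𝓡 m) (n := ∞) (s := ε i)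
      have hb : (trivializationAt (F →L[ℝ] ℝ) (DualBundle E) x).baseSet = e.baseSet := by
        rw [hom_trivializationAt_baseSet]; simp [e]
      rw [hb] at h
      rw [h]
      refine (contMDiffOn_const (c := LinearMap.toContinuousLinearMap (b.coord i))).congr ?_
      intro y hy
      rw [hom_trivializationAt_apply]
      ext u
      simp only [ContinuousLinearMap.inCoordinates, ContinuousLinearMap.comp_apply, ε]
      rw [e.continuousLinearMapAt_symmL hy]
      simp
    let v : Fin (Module.finrank ℝ F) → Sec m F E := fun i =>
      ⟨(ψ : M → ℝ) • e.localFrame b i, ContMDiffOn.smul_section_of_tsupport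
        ψ.contMDiff.contMDiffOn e.open_baseSet hψ (e.contMDiffOn_localFrame_baseSet ∞ b i)⟩
    let w : Fin (Module.finrank ℝ F) → Sec m (F →L[ℝ] ℝ) (DualBundle E) := fun i =>
      ⟨(ψ : M → ℝ) • ε i, ContMDiffOn.smul_section_of_tsupport
        ψ.contMDiff.contMDiffOn e.open_baseSet hψ (hε i)⟩
    have hv : ∀ i y, v i y = ψ y • e.localFrame b i y := fun _ _ => rfl
    have hw : ∀ i y, w i y = ψ y • ε i y := fun _ _ => rfl
    have hψ0 : ∀ y, y ∉ e.baseSet → ψ y = 0 := fun y hy => by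
      by_contra h
      exact hy (hψ (subset_tsupport _ h))
    have hsum : ∀ y ∈ e.baseSet, ∀ u : E y, ∑ i, (ε i y u : ℝ) • e.localFrame b i y = u := by
      intro y hy u
      conv_rhs => rw [← (e.basisAt b hy).sum_repr u]
      refine Finset.sum_congr rfl fun i _ => ?_
      rw [e.localFrame_apply_of_mem_baseSet b hy]
      congr 1
      simp [ε, Trivialization.basisAt, e.coe_linearMapAt_of_mem hy]
    let χ : Fun m M := ⟨fun y => ψ y * ψ y, ψ.contMDiff.mul ψ.contMDiff⟩
    have hχ : ∀ y, χ y = ψ y * ψ y := fun _ => rfl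
    refine ⟨_, v, w, χ, ?_, fun X => ContMDiffSection.ext fun y => ?_,
      fun ξ => ContMDiffSection.ext fun y => ?_⟩
    · filter_upwards [ψ.eventuallyEq_one] with y hy
      rw [hχ, hy]; simp
    · rw [Sec.fun_smul_apply, Sec.sum_apply, hχ]
      by_cases hy : y ∈ e.baseSet
      · conv_lhs => rw [← hsum y hy (X y), Finset.smul_sum]
        refine Finset.sum_congr rfl fun i _ => ?_
        rw [Sec.fun_smul_apply, pairing_apply, hv, hw]
        change _ = (ψ y * ε i y (X y)) • _
        rw [smul_smul, smul_smul]
        congr 1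
        ring
      · rw [hψ0 y hy, mul_zero, zero_smul]
        refine (Finset.sum_eq_zero fun i _ => ?_).symm
        rw [Sec.fun_smul_apply, hv, hψ0 y hy, zero_smul, smul_zero]
    · rw [Sec.fun_smul_apply, Sec.sum_apply, hχ]
      by_cases hy : y ∈ e.baseSet
      · refine ContinuousLinearMap.ext fun u => ?_
        rw [sum_apply]
        change ψ y * ψ y * ξ y u = _
        have h := congrArg (ξ y) (hsum y hy u)
        rw [map_sum] at h
        rw [← h]
        change ψ y * ψ y * ∑ i, ξ y ((ε i y u : ℝ) • e.localFrame b i y) = _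
        rw [Finset.mul_sum]
        refine Finset.sum_congr rfl fun i _ => ?_
        have h1 : ξ y ((ε i y u : ℝ) • e.localFrame b i y) =
          (ε i y u : ℝ) * (ξ y (e.localFrame b i y) : ℝ) := map_smul (ξ y) _ _
        have h2 : ξ y (v i y) = ψ y * (ξ y (e.localFrame b i y) : ℝ) := by
          rw [hv]; exact map_smul (ξ y) _ _
        rw [h1]
        change _ = (ξ y (v i y) : ℝ) * (ψ y * (ε i y u : ℝ))
        rw [h2]
        ring
      · rw [hψ0 y hy, mul_zero, zero_smul]
        refine (Finset.sum_eq_zero fun i _ => ?_).symm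
        rw [Sec.fun_smul_apply, hw, hψ0 y hy, zero_smul, smul_zero]

/-- The pairing of `Sec(E)` and `Sec(E*)` is perfect: every `C^∞(M)`-linear map `Sec(E) → C^∞(M)` is
given by a unique section of `E*`, and every `C^∞(M)`-linear map `Sec(E*) → C^∞(M)` by a unique
section of `E`. -/
instance isPerfPair_pairing [T2Space M] [IsManifold (𝓡 m) ∞ M] [FiniteDimensional ℝ F]
    [ContMDiffVectorBundle ∞ F E (𝓡 m)] : (pairing m F E).IsPerfPair :=
  hasDualFrames_pairing.isPerfPair

end Dual

/-! ### Lie algebroids -/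

section Algebroid

variable {m : ℕ} {M : Type*} [TopologicalSpace M] [ChartedSpace (EuclideanSpace ℝ (Fin m)) M]
  [IsManifold (𝓡 m) ∞ M]
  {F : Type*} [NormedAddCommGroup F] [NormedSpace ℝ F]
  {V : M → Type*} [TopologicalSpace (TotalSpace F V)] [∀ x, TopologicalSpace (V x)]
  [∀ x, AddCommGroup (V x)] [∀ x, Module ℝ (V x)] [FiberBundle F V] [VectorBundle ℝ F V]

variable (m F V) in
/-- Smooth vector bundle maps `V → TM` over the identity of `M`. -/
abbrev AnchorMap : Type _ :=
  Cₛ^∞⟮𝓡 m; F →L[ℝ] EuclideanSpace ℝ (Fin m), fun x => V x →L[ℝ] TangentSpace (𝓡 m) x⟯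

/-- The derivative `a(X)(f)` of a function `f` along the vector field `a(X)`. -/
def AnchorMap.deriv (a : AnchorMap m F V) (X : Sec m F V) (f : Fun m M) : Fun m M :=
  ⟨fun x => mvfderiv (𝓡 m) f x (a x (X x)), by
    have h := ContMDiff.clm_bundle_apply a.contMDiff X.contMDiff
    have hf := (f.contMDiff.contMDiff_tangentMap (m := ∞) (by simp)).comp h
    exact (contMDiff_snd_tangentBundle_modelSpace ℝ 𝓘(ℝ, ℝ)).comp hf⟩

theorem AnchorMap.deriv_apply (a : AnchorMap m F V) (X : Sec m F V) (f : Fun m M) (x : M) :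
    a.deriv X f x = mvfderiv (𝓡 m) f x (a x (X x)) := rfl

theorem AnchorMap.deriv_add_left (a : AnchorMap m F V) (X Y : Sec m F V) (f : Fun m M) :
    a.deriv (X + Y) f = a.deriv X f + a.deriv Y f := ContMDiffMap.ext fun x => by
  change mvfderiv (𝓡 m) f x (a x (X x + Y x)) = _
  rw [map_add, map_add]; rfl

theorem AnchorMap.deriv_smul_left (a : AnchorMap m F V) (g : Fun m M) (X : Sec m F V)
    (f : Fun m M) : a.deriv (g • X) f = g * a.deriv X f := ContMDiffMap.ext fun x => by
  change mvfderiv (𝓡 m) f x (a x (g x • X x)) = _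
  rw [map_smul, map_smul]; rfl

theorem AnchorMap.deriv_add_right (a : AnchorMap m F V) (X : Sec m F V) (f g : Fun m M) :
    a.deriv X (f + g) = a.deriv X f + a.deriv X g := ContMDiffMap.ext fun x => by
  change mvfderiv (𝓡 m) (⇑f + ⇑g) x (a x (X x)) = _
  rw [mvfderiv_add (f.mdifferentiableAt x) (g.mdifferentiableAt x)]; rfl

theorem AnchorMap.deriv_mul_right (a : AnchorMap m F V) (X : Sec m F V) (f g : Fun m M) :
    a.deriv X (f * g) = f * a.deriv X g + a.deriv X f * g := ContMDiffMap.ext fun x => by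
  change mvfderiv (𝓡 m) (⇑f * ⇑g) x (a x (X x)) = _
  rw [mvfderiv_mul (f.mdifferentiableAt x) (g.mdifferentiableAt x)]
  change f x * a.deriv X g x + g x * a.deriv X f x = f x * a.deriv X g x + a.deriv X f x * g x
  ring

variable (m F V) in
/-- A Lie algebroid structure on the vector bundle `V`: a Lie bracket on `Sec(V)` and a vector
bundle map `V → TM`, the anchor, satisfying the Leibniz rule, the anchor being a homomorphism into
the Lie algebra of vector fields. -/
structure LieAlgebroid where
  /-- the bracket `[X, Y]` -/
  bracket : Sec m F V →ₗ[ℝ] Sec m F V →ₗ[ℝ] Sec m F V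
  /-- the anchor -/
  anchor : AnchorMap m F V
  bracket_self : ∀ X, bracket X X = 0
  jacobi : ∀ X Y Z, bracket X (bracket Y Z) = bracket (bracket X Y) Z + bracket Y (bracket X Z)
  leibniz : ∀ X (f : Fun m M) Y, bracket X (f • Y) = f • bracket X Y + anchor.deriv X f • Y
  anchor_bracket : ∀ X Y f, anchor.deriv (bracket X Y) f =
    anchor.deriv X (anchor.deriv Y f) - anchor.deriv Y (anchor.deriv X f)

namespace LieAlgebroid

variable {G : Type*} [NormedAddCommGroup G] [NormedSpace ℝ G]
  {W : M → Type*} [TopologicalSpace (TotalSpace G W)] [∀ x, TopologicalSpace (W x)]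
  [∀ x, AddCommGroup (W x)] [∀ x, Module ℝ (W x)] [FiberBundle G W] [VectorBundle ℝ G W]
  (A : LieAlgebroid m F V) (B : LieAlgebroid m G W)
  (p : Sec m F V →ₗ[Fun m M] Sec m G W →ₗ[Fun m M] Fun m M)

/-! #### Cartan calculus

`A` is a Lie algebroid on `V` and `p` is a pairing of `V` with a bundle `W`, by which sections of
`W` are the one-forms of `A`. It is used for `V = E`, `W = E*`, and for `V = E*`, `W = E`. -/

/-- The linear form `X ↦ a(X)(f)`. -/
def dFunForm (f : Fun m M) : Sec m F V →ₗ[Fun m M] Fun m M where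
  toFun X := A.anchor.deriv X f
  map_add' X Y := A.anchor.deriv_add_left X Y f
  map_smul' g X := A.anchor.deriv_smul_left g X f

/-- The linear form `Y ↦ a(X)⟨Y, ξ⟩ - ⟨[X, Y], ξ⟩`. -/
def lieForm (X : Sec m F V) (ξ : Sec m G W) : Sec m F V →ₗ[Fun m M] Fun m M where
  toFun Y := A.anchor.deriv X (p Y ξ) - p (A.bracket X Y) ξ
  map_add' Y Z := by
    simp only [map_add, LinearMap.add_apply, AnchorMap.deriv_add_right]; ring
  map_smul' f Y := by
    simp only [A.leibniz, map_add, map_smul, LinearMap.add_apply, LinearMap.smul_apply,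
      smul_eq_mul, AnchorMap.deriv_mul_right, RingHom.id_apply]
    ring

theorem bracket_skew (X Y : Sec m F V) : A.bracket X Y = -A.bracket Y X := by
  have h := A.bracket_self (X + Y)
  simp only [map_add, LinearMap.add_apply, A.bracket_self, zero_add, add_zero] at h
  rw [eq_neg_iff_add_eq_zero, add_comm]
  exact h

/-- The value `dξ(X, Y) = a(X)⟨Y, ξ⟩ - a(Y)⟨X, ξ⟩ - ⟨[X, Y], ξ⟩` of the differential of a
one-form `ξ`. -/
def dOne (ξ : Sec m G W) (X Y : Sec m F V) : Fun m M :=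
  A.anchor.deriv X (p Y ξ) - A.anchor.deriv Y (p X ξ) - p (A.bracket X Y) ξ

/-- The linear form `Y ↦ dξ(X, Y)`. -/
def dOneForm (ξ : Sec m G W) (X : Sec m F V) : Sec m F V →ₗ[Fun m M] Fun m M where
  toFun Y := A.dOne p ξ X Y
  map_add' Y Z := by
    simp only [dOne, map_add, LinearMap.add_apply, AnchorMap.deriv_add_right,
      AnchorMap.deriv_add_left]
    ring
  map_smul' f Y := by
    simp only [dOne, A.leibniz, map_add, map_smul, LinearMap.add_apply, LinearMap.smul_apply,
      smul_eq_mul, AnchorMap.deriv_mul_right, AnchorMap.deriv_smul_left, RingHom.id_apply]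
    ring

/-- The value `dΩ(X, Y, Z)` of the differential of the two-form `Ω(X, Y) = ⟨Y, Ω X⟩`. -/
def dTwo (Ω : Sec m F V →ₗ[Fun m M] Sec m G W) (X Y Z : Sec m F V) : Fun m M :=
  A.anchor.deriv X (p Z (Ω Y)) - A.anchor.deriv Y (p Z (Ω X)) + A.anchor.deriv Z (p Y (Ω X))
    - p Z (Ω (A.bracket X Y)) + p Y (Ω (A.bracket X Z)) - p X (Ω (A.bracket Y Z))

variable [p.IsPerfPair]

/-- The differential `df` of a function. -/
def d (f : Fun m M) : Sec m G W := represent p (A.dFunForm f)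

/-- The Lie derivative `L_X ξ` of a one-form. -/
def lie (X : Sec m F V) (ξ : Sec m G W) : Sec m G W := represent p (A.lieForm p X ξ)

/-- The one-form `i_X dξ`. -/
def iotaD (X : Sec m F V) (ξ : Sec m G W) : Sec m G W := represent p (A.dOneForm p ξ X)

/-- `dK(X, Y, ·) = L_X (K Y) - i_Y d(K X) - K [X, Y]`, for any bundle map `K : V → W`, which need
not be skew-symmetric. -/
def dMap (K : Sec m F V →ₗ[Fun m M] Sec m G W) (X Y : Sec m F V) : Sec m G W :=
  A.lie p X (K Y) - A.iotaD p Y (K X) - K (A.bracket X Y)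

/-- The bracket `[X, Y]^K = L_{K X} Y - L_{K Y} X + d⟨X, K Y⟩` on `Sec(V)` defined by a bundle map
`K : V → W`, which need not be skew-symmetric, and a Lie algebroid `B` on `W`. -/
def bracketOf (K : Sec m F V →ₗ[Fun m M] Sec m G W) (X Y : Sec m F V) : Sec m F V :=
  B.lie p.flip (K X) Y - B.lie p.flip (K Y) X + B.d p.flip (p X (K Y))

end LieAlgebroid

/-- `Ω : V → W` is skew-symmetric. -/
def IsSkew {G : Type*} [NormedAddCommGroup G] [NormedSpace ℝ G]
    {W : M → Type*} [TopologicalSpace (TotalSpace G W)] [∀ x, TopologicalSpace (W x)]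
    [∀ x, AddCommGroup (W x)] [∀ x, Module ℝ (W x)] [FiberBundle G W] [VectorBundle ℝ G W]
    (p : Sec m F V →ₗ[Fun m M] Sec m G W →ₗ[Fun m M] Fun m M)
    (Ω : Sec m F V →ₗ[Fun m M] Sec m G W) : Prop :=
  ∀ X Y, p Y (Ω X) = -p X (Ω Y)

/-- The transpose `Sec(V) → Sec(V)` of a map `K : Sec(W) → Sec(W)`. -/
def transpose {G : Type*} [NormedAddCommGroup G] [NormedSpace ℝ G]
    {W : M → Type*} [TopologicalSpace (TotalSpace G W)] [∀ x, TopologicalSpace (W x)]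
    [∀ x, AddCommGroup (W x)] [∀ x, Module ℝ (W x)] [FiberBundle G W] [VectorBundle ℝ G W]
    (p : Sec m F V →ₗ[Fun m M] Sec m G W →ₗ[Fun m M] Fun m M) [p.IsPerfPair]
    (K : Sec m G W →ₗ[Fun m M] Sec m G W) : Sec m F V →ₗ[Fun m M] Sec m F V :=
  p.toPerfPair.symm.toLinearMap ∘ₗ K.dualMap ∘ₗ p.toPerfPair.toLinearMap

end Algebroid

/-! ### Contracted products and Nijenhuis torsion -/

section Contraction

variable {S : Type*} [AddCommGroup S]

/-- The contracted product `X ∘_N Y = N X ∘ Y + X ∘ N Y - N (X ∘ Y)`. -/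
def contract (op : S → S → S) (N : S → S) (X Y : S) : S :=
  op (N X) Y + op X (N Y) - N (op X Y)

/-- The Nijenhuis torsion `T_N(X, Y) = N X ∘ N Y - N (X ∘_N Y)`. -/
def torsion (op : S → S → S) (N : S → S) (X Y : S) : S :=
  op (N X) (N Y) - N (contract op N X Y)

/-- `N` is an outer Nijenhuis tensor for the subalgebra `L`: the contracted product is closed on `L`
and the torsion of `N` vanishes on `L`. -/
def IsOuterNijenhuis (op : S → S → S) (N : S → S) (L : Set S) : Prop :=
  (∀ X ∈ L, ∀ Y ∈ L, contract op N X Y ∈ L) ∧ ∀ X ∈ L, ∀ Y ∈ L, torsion op N X Y = 0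

end Contraction

/-! ### Lie bialgebroids -/

section Bialgebroid

variable {m : ℕ} {M : Type*} [TopologicalSpace M] [T2Space M]
  [ChartedSpace (EuclideanSpace ℝ (Fin m)) M] [IsManifold (𝓡 m) ∞ M]
  {F : Type*} [NormedAddCommGroup F] [NormedSpace ℝ F] [FiniteDimensional ℝ F]
  {E : M → Type*} [TopologicalSpace (TotalSpace F E)] [∀ x, TopologicalSpace (E x)]
  [∀ x, AddCommGroup (E x)] [∀ x, Module ℝ (E x)] [FiberBundle F E] [VectorBundle ℝ F E]
  [ContMDiffVectorBundle ∞ F E (𝓡 m)]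

variable (m F E) in
/-- The space `Sec(E*)` of smooth sections of the dual bundle. -/
abbrev DualSec : Type _ := Sec m (F →L[ℝ] ℝ) (DualBundle E)

variable (m F E) in
/-- The space of smooth sections of `A = E ⊕ E*`; the pair `(X, ξ)` is the section `X + ξ`. -/
abbrev DoubleSec : Type _ := Sec m F E × DualSec m F E

/-- The Lie derivative `(L_X P)(ξ, η) = a(X) P(ξ, η) - P(L_X ξ, η) - P(ξ, L_X η)` of a bivector
field `P`, given as a bilinear form on one-forms. It is the Schouten bracket `[X, P]`. -/
def lieBivector (A : LieAlgebroid m F E) (X : Sec m F E)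
    (P : DualSec m F E → DualSec m F E → Fun m M) (ξ η : DualSec m F E) : Fun m M :=
  A.anchor.deriv X (P ξ η) - P (A.lie (pairing m F E) X ξ) η - P ξ (A.lie (pairing m F E) X η)

variable (m F E) in
/-- A Lie bialgebroid `(E, E*)`: Lie algebroid structures on `E` and on the dual bundle `E*` such
that `d_{E*}` is a derivation of the Schouten bracket of `E`, that is
`d_{E*}[X, Y] = [d_{E*}X, Y] + [X, d_{E*}Y] = L_X d_{E*}Y - L_Y d_{E*}X` for sections of `E`. -/
structure LieBialgebroid where
  /-- the Lie algebroid `E` -/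
  base : LieAlgebroid m F E
  /-- the Lie algebroid `E*` -/
  dual : LieAlgebroid m (F →L[ℝ] ℝ) (DualBundle E)
  compatible : ∀ (X Y : Sec m F E) (ξ η : DualSec m F E),
    dual.dOne (pairing m F E).flip (base.bracket X Y) ξ η =
      lieBivector base X (dual.dOne (pairing m F E).flip Y) ξ η -
      lieBivector base Y (dual.dOne (pairing m F E).flip X) ξ η

/-- The pairing `⟨X + ξ, Y + η⟩ = ⟨ξ, Y⟩ + ⟨η, X⟩` on `E ⊕ E*`. -/
def doublePairing (a b : DoubleSec m F E) : Fun m M :=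
  pairing m F E b.1 a.2 + pairing m F E a.1 b.2

/-- The Courant product on sections of `E ⊕ E*`,
`(X + ξ) ∘ (Y + η) = ([X, Y] + L_ξ Y - i_η dX) + ([ξ, η] + L_X η - i_Y dξ)`. -/
def LieBialgebroid.courant (D : LieBialgebroid m F E) (a b : DoubleSec m F E) : DoubleSec m F E :=
  (D.base.bracket a.1 b.1 + D.dual.lie (pairing m F E).flip a.2 b.1
      - D.dual.iotaD (pairing m F E).flip b.2 a.1,
    D.dual.bracket a.2 b.2 + D.base.lie (pairing m F E) a.1 b.2
      - D.base.iotaD (pairing m F E) b.1 a.2)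

/-- The tensor on `E ⊕ E*` with matrix `(N_E, Λ; Ω, N_{E*})`:
`X + ξ ↦ (N_E X + Λ ξ) + (Ω X + N_{E*} ξ)`. -/
def blockMatrix (NE : Sec m F E →ₗ[Fun m M] Sec m F E)
    (Λ : DualSec m F E →ₗ[Fun m M] Sec m F E) (Ω : Sec m F E →ₗ[Fun m M] DualSec m F E)
    (NE' : DualSec m F E →ₗ[Fun m M] DualSec m F E) :
    DoubleSec m F E →ₗ[Fun m M] DoubleSec m F E :=
  (NE.coprod Λ).prod (Ω.coprod NE')

/-- `N` is paired: `N + N* = λ I` for some real `λ`, where `N*` is the adjoint of `N` with respect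
to the pairing of `E ⊕ E*`, that is `⟨N a, b⟩ + ⟨a, N b⟩ = λ ⟨a, b⟩`. -/
def IsPaired (N : DoubleSec m F E →ₗ[Fun m M] DoubleSec m F E) : Prop :=
  ∃ lam : ℝ, ∀ a b, doublePairing (N a) b + doublePairing a (N b) = lam • doublePairing a b

/-- `(E, E*, N)` is a Lie bialgebroid-Nijenhuis structure: `N` is paired and is an outer Nijenhuis
tensor for both subbundles `E` and `E*` of `E ⊕ E*`. -/
def LieBialgebroid.IsNijenhuis (D : LieBialgebroid m F E)
    (N : DoubleSec m F E →ₗ[Fun m M] DoubleSec m F E) : Prop :=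
  IsPaired N ∧ IsOuterNijenhuis D.courant N {a | a.2 = 0} ∧
    IsOuterNijenhuis D.courant N {a | a.1 = 0}

end Bialgebroid

end LieBialg
end

/-!
The equivalence is a comparison of components. Evaluated on two sections of `E`, the pairing
condition `N + N* = λ I` says that `Ω` is skew-symmetric, on two sections of `E*` that `Λ` is, and
on a section of each that `N_E + ᵗN_{E*} = λ I` (`isPaired_blockMatrix_iff`).

For sections `X`, `Y` of `E`, Cartan's formula `i_η dX = L_η X - d⟨X, η⟩`
(`LieAlgebroid.iotaD_eq_lie_sub_d`) gives
`X ∘_N Y = ([X, Y]_{N_E} + [X, Y]^Ω) + dΩ(X, Y, ·)`. Hence `Sec(E)` is closed under `∘_N` iff the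
one-forms `dΩ(X, Y, ·)` vanish, which for a skew-symmetric `Ω` means `dΩ = 0`
(`LieAlgebroid.dMap_eq_zero_iff_dTwo`). When this holds, the `E`-component of `T_N(X, Y)` is
`T_{N_E}(X, Y) + [X, Y]^Ω_{N_E} - [X, Y]^{Ω N_E}`, and the `E*`-component is
`[ΩX, ΩY] - Ω [X, Y]^Ω - d(Ω N_E)(X, Y, ·)` up to the vanishing terms
`dΩ(N_E X, Y, ·) + dΩ(X, N_E Y, ·)`.

The Courant product is symmetric under the exchange of `E` and `E*`, so the computation is done once
for two algebroids `A` on `V` and `B` on `W` in duality (`isOuterNijenhuis_crossedProduct_iff`), and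
used for `(E, E*)` and for `(E*, E)`.
-/

open Bundle Function
open scoped Manifold ContDiff Topology

noncomputable section

namespace LieBialg

/-! ### Cartan calculus -/

section Algebroid

variable {m : ℕ} {M : Type*} [TopologicalSpace M] [ChartedSpace (EuclideanSpace ℝ (Fin m)) M]
  [IsManifold (𝓡 m) ∞ M]
  {F : Type*} [NormedAddCommGroup F] [NormedSpace ℝ F]
  {V : M → Type*} [TopologicalSpace (TotalSpace F V)] [∀ x, TopologicalSpace (V x)]
  [∀ x, AddCommGroup (V x)] [∀ x, Module ℝ (V x)] [FiberBundle F V] [VectorBundle ℝ F V]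
  {G : Type*} [NormedAddCommGroup G] [NormedSpace ℝ G]
  {W : M → Type*} [TopologicalSpace (TotalSpace G W)] [∀ x, TopologicalSpace (W x)]
  [∀ x, AddCommGroup (W x)] [∀ x, Module ℝ (W x)] [FiberBundle G W] [VectorBundle ℝ G W]
  (A : LieAlgebroid m F V) (B : LieAlgebroid m G W)
  (p : Sec m F V →ₗ[Fun m M] Sec m G W →ₗ[Fun m M] Fun m M) [p.IsPerfPair]

omit [IsManifold (𝓡 m) ∞ M] in
theorem eq_of_pairing_eq {ξ η : Sec m G W} (h : ∀ X, p X ξ = p X η) : ξ = η :=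
  p.flip.toPerfPair.injective (LinearMap.ext h)

namespace LieAlgebroid

theorem pairing_d (f : Fun m M) (X : Sec m F V) : p X (A.d p f) = A.anchor.deriv X f :=
  represent_spec p _ X

theorem pairing_lie (X : Sec m F V) (ξ : Sec m G W) (Y : Sec m F V) :
    p Y (A.lie p X ξ) = A.anchor.deriv X (p Y ξ) - p (A.bracket X Y) ξ :=
  represent_spec p _ Y

theorem pairing_iotaD (X : Sec m F V) (ξ : Sec m G W) (Y : Sec m F V) :
    p Y (A.iotaD p X ξ) =
      A.anchor.deriv X (p Y ξ) - A.anchor.deriv Y (p X ξ) - p (A.bracket X Y) ξ :=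
  represent_spec p _ Y

theorem deriv_zero_left (f : Fun m M) : A.anchor.deriv 0 f = 0 := map_zero (A.dFunForm f)

theorem deriv_zero_right (X : Sec m F V) : A.anchor.deriv X 0 = 0 := by
  simpa using A.anchor.deriv_add_right X 0 0

theorem lie_zero_left (ξ : Sec m G W) : A.lie p 0 ξ = 0 :=
  eq_of_pairing_eq p fun Y => by
    rw [pairing_lie, deriv_zero_left, map_zero, LinearMap.zero_apply, map_zero,
      LinearMap.zero_apply, sub_zero, map_zero]

theorem lie_zero_right (X : Sec m F V) : A.lie p X 0 = 0 :=
  eq_of_pairing_eq p fun Y => by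
    rw [pairing_lie, map_zero, map_zero, deriv_zero_right, sub_zero]

theorem d_zero : A.d p 0 = 0 :=
  eq_of_pairing_eq p fun Y => by rw [pairing_d, deriv_zero_right, map_zero]

/-- Cartan's formula `i_X dξ = L_X ξ - d⟨X, ξ⟩`. -/
theorem iotaD_eq_lie_sub_d (X : Sec m F V) (ξ : Sec m G W) :
    A.iotaD p X ξ = A.lie p X ξ - A.d p (p X ξ) :=
  eq_of_pairing_eq p fun Y => by
    rw [map_sub, pairing_iotaD, pairing_lie, pairing_d]; abel

/-- For a skew-symmetric `Ω`, the one-forms `dΩ(X, Y, ·) = L_X (Ω Y) - i_Y d(Ω X) - Ω [X, Y]` are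
the contractions of the three-form `dΩ`. -/
theorem pairing_dMap {Ω : Sec m F V →ₗ[Fun m M] Sec m G W} (hΩ : IsSkew p Ω)
    (X Y Z : Sec m F V) : p Z (A.dMap p Ω X Y) = A.dTwo p Ω X Y Z := by
  rw [dMap, dTwo, map_sub, map_sub, pairing_lie, pairing_iotaD, hΩ (A.bracket X Z) Y,
    ← neg_eq_iff_eq_neg.2 (hΩ (A.bracket Y Z) X)]
  abel

theorem dMap_eq_zero_iff_dTwo {Ω : Sec m F V →ₗ[Fun m M] Sec m G W}
    (hΩ : IsSkew p Ω) :
    (∀ X Y, A.dMap p Ω X Y = 0) ↔ ∀ X Y Z, A.dTwo p Ω X Y Z = 0 := by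
  refine forall₂_congr fun X Y => ⟨fun h Z => ?_, fun h => eq_of_pairing_eq p fun Z => ?_⟩
  · rw [← A.pairing_dMap p hΩ, h, map_zero]
  · rw [A.pairing_dMap p hΩ, h, map_zero]

end LieAlgebroid

/-! ### Outer Nijenhuis tensors for one summand -/

/-- The Courant product of `V ⊕ W` for Lie algebroids `A` on `V` and `B` on `W` in duality by `p`.
It is symmetric in `(A, V)` and `(B, W)`. -/
def crossedProduct (a b : Sec m F V × Sec m G W) : Sec m F V × Sec m G W :=
  (A.bracket a.1 b.1 + B.lie p.flip a.2 b.1 - B.iotaD p.flip b.2 a.1,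
    B.bracket a.2 b.2 + A.lie p a.1 b.2 - A.iotaD p b.1 a.2)

/-- The endomorphism of `V ⊕ W` with matrix `(N, Λ; Ω, N')`. -/
def blockMap (N : Sec m F V →ₗ[Fun m M] Sec m F V) (Λ : Sec m G W →ₗ[Fun m M] Sec m F V)
    (Ω : Sec m F V →ₗ[Fun m M] Sec m G W) (N' : Sec m G W →ₗ[Fun m M] Sec m G W) :
    Sec m F V × Sec m G W →ₗ[Fun m M] Sec m F V × Sec m G W :=
  (N.coprod Λ).prod (Ω.coprod N')

variable (N : Sec m F V →ₗ[Fun m M] Sec m F V) (Λ : Sec m G W →ₗ[Fun m M] Sec m F V)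
  (Ω : Sec m F V →ₗ[Fun m M] Sec m G W) (N' : Sec m G W →ₗ[Fun m M] Sec m G W)

omit [IsManifold (𝓡 m) ∞ M] in
/-- On sections of `V` the matrix acts through its first column. -/
theorem blockMap_inl (X : Sec m F V) : blockMap N Λ Ω N' (X, 0) = (N X, Ω X) := by
  simp [blockMap]

/-- `Sec(V)` is a subalgebra of the Courant product. -/
theorem crossedProduct_inl (X Y : Sec m F V) :
    crossedProduct A B p (X, 0) (Y, 0) = (A.bracket X Y, 0) := by
  simp [crossedProduct, LieAlgebroid.iotaD_eq_lie_sub_d, LieAlgebroid.lie_zero_left,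
    LieAlgebroid.lie_zero_right, LieAlgebroid.d_zero]

/-- The contracted product of two sections of `V` is `[X, Y]_N + [X, Y]^Ω` up to the one-form
`dΩ(X, Y, ·)`. -/
theorem contract_crossedProduct_inl (X Y : Sec m F V) :
    contract (crossedProduct A B p) (blockMap N Λ Ω N') (X, 0) (Y, 0) =
      (contract (fun X Y => A.bracket X Y) N X Y + B.bracketOf p Ω X Y, A.dMap p Ω X Y) := by
  rw [contract, crossedProduct_inl, blockMap_inl, blockMap_inl, blockMap_inl]
  ext1
  · simp only [crossedProduct, contract, LieAlgebroid.bracketOf, LieAlgebroid.iotaD_eq_lie_sub_d,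
      LieAlgebroid.lie_zero_left, LieAlgebroid.d_zero, map_zero, LinearMap.zero_apply,
      Prod.fst_add, Prod.fst_sub, LinearMap.flip_apply]
    abel
  · simp only [crossedProduct, LieAlgebroid.dMap, LieAlgebroid.iotaD_eq_lie_sub_d,
      LieAlgebroid.lie_zero_right, LieAlgebroid.d_zero, map_zero, LinearMap.zero_apply,
      Prod.snd_add, Prod.snd_sub]
    abel

/-- The torsion on sections of `V`, once `Sec(V)` is closed under the contracted product. -/
theorem torsion_crossedProduct_inl (hΩ : ∀ X Y, A.dMap p Ω X Y = 0) (X Y : Sec m F V) :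
    torsion (crossedProduct A B p) (blockMap N Λ Ω N') (X, 0) (Y, 0) =
      (torsion (fun X Y => A.bracket X Y) N X Y + contract (B.bracketOf p Ω) N X Y
          - B.bracketOf p (Ω ∘ₗ N) X Y,
        B.bracket (Ω X) (Ω Y) - Ω (B.bracketOf p Ω X Y) - A.dMap p (Ω ∘ₗ N) X Y) := by
  rw [torsion, contract_crossedProduct_inl, hΩ, blockMap_inl, blockMap_inl, blockMap_inl]
  ext1
  · simp only [crossedProduct, torsion, contract, LieAlgebroid.bracketOf,
      LieAlgebroid.iotaD_eq_lie_sub_d, Prod.fst_sub, LinearMap.flip_apply, LinearMap.comp_apply,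
      map_add, map_sub]
    abel
  · have h : A.dMap p Ω (N X) Y + A.dMap p Ω X (N Y) = 0 := by rw [hΩ, hΩ, add_zero]
    rw [← sub_eq_zero, ← h]
    simp only [crossedProduct, contract, LieAlgebroid.dMap, Prod.snd_sub, LinearMap.comp_apply,
      map_add, map_sub]
    abel

theorem isOuterNijenhuis_crossedProduct_iff :
    IsOuterNijenhuis (crossedProduct A B p) (blockMap N Λ Ω N') {a | a.2 = 0} ↔
      (∀ X Y, A.dMap p Ω X Y = 0) ∧
      (∀ X Y, torsion (fun X Y => A.bracket X Y) N X Y + contract (B.bracketOf p Ω) N X Y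
          - B.bracketOf p (Ω ∘ₗ N) X Y = 0) ∧
      (∀ X Y, B.bracket (Ω X) (Ω Y) - Ω (B.bracketOf p Ω X Y) - A.dMap p (Ω ∘ₗ N) X Y = 0) := by
  have hset : ∀ P : Sec m F V × Sec m G W → Sec m F V × Sec m G W → Prop,
      (∀ a ∈ {a : Sec m F V × Sec m G W | a.2 = 0}, ∀ b ∈ {a : Sec m F V × Sec m G W | a.2 = 0},
        P a b) ↔ ∀ X Y, P (X, 0) (Y, 0) := by
    refine fun P => ⟨fun h X Y => h _ rfl _ rfl, ?_⟩
    rintro h ⟨X, _⟩ rfl ⟨Y, _⟩ rfl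
    exact h X Y
  rw [IsOuterNijenhuis, hset, hset]
  simp only [contract_crossedProduct_inl, Set.mem_ofPred_eq]
  refine and_congr_right fun hΩ => ?_
  simp only [torsion_crossedProduct_inl A B p N Λ Ω N' hΩ, Prod.mk_eq_zero, forall_and]

end Algebroid

/-- Transport of outer Nijenhuis tensors along an isomorphism `e` of the products. -/
theorem isOuterNijenhuis_congr {S T : Type*} [AddCommGroup S] [AddCommGroup T] (e : S ≃+ T)
    {op : S → S → S} {op' : T → T → T} {N : S → S} {N' : T → T} {L : Set S} {L' : Set T}
    (hop : ∀ a b, e (op a b) = op' (e a) (e b)) (hN : ∀ a, e (N a) = N' (e a))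
    (hL : ∀ a, e a ∈ L' ↔ a ∈ L) : IsOuterNijenhuis op N L ↔ IsOuterNijenhuis op' N' L' := by
  have hc : ∀ a b, e (contract op N a b) = contract op' N' (e a) (e b) := fun a b => by
    simp only [contract, map_add, map_sub, hop, hN]
  have ht : ∀ a b, e (torsion op N a b) = torsion op' N' (e a) (e b) := fun a b => by
    simp only [torsion, map_sub, hop, hN, hc]
  simp only [IsOuterNijenhuis, e.surjective.forall, hL, ← hc, ← ht, EmbeddingLike.map_eq_zero_iff]

/-! ### Lie bialgebroids -/

section Bialgebroid

variable {m : ℕ} {M : Type*} [TopologicalSpace M] [T2Space M]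
  [ChartedSpace (EuclideanSpace ℝ (Fin m)) M] [IsManifold (𝓡 m) ∞ M]
  {F : Type*} [NormedAddCommGroup F] [NormedSpace ℝ F] [FiniteDimensional ℝ F]
  {E : M → Type*} [TopologicalSpace (TotalSpace F E)] [∀ x, TopologicalSpace (E x)]
  [∀ x, AddCommGroup (E x)] [∀ x, Module ℝ (E x)] [FiberBundle F E] [VectorBundle ℝ F E]
  [ContMDiffVectorBundle ∞ F E (𝓡 m)]
  (D : LieBialgebroid m F E)
  (NE : Sec m F E →ₗ[Fun m M] Sec m F E) (Λ : DualSec m F E →ₗ[Fun m M] Sec m F E)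
  (Ω : Sec m F E →ₗ[Fun m M] DualSec m F E) (NE' : DualSec m F E →ₗ[Fun m M] DualSec m F E)

theorem pairing_transpose (X : Sec m F E) (η : DualSec m F E) :
    pairing m F E (transpose (pairing m F E) NE' X) η = pairing m F E X (NE' η) := by
  change (pairing m F E).toPerfPair ((pairing m F E).toPerfPair.symm _) η = _
  rw [LinearEquiv.apply_symm_apply]
  rfl

omit [T2Space M] [IsManifold (𝓡 m) ∞ M] [FiniteDimensional ℝ F]
  [ContMDiffVectorBundle ∞ F E (𝓡 m)] in
theorem pairing_real_smul (c : ℝ) (X : Sec m F E) (η : DualSec m F E) :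
    pairing m F E (c • X) η = c • pairing m F E X η :=
  ContMDiffMap.ext fun x => map_smul (η x) c (X x)

/-- The pairing condition, evaluated on pairs of sections of `E` and `E*`. -/
theorem isPaired_blockMatrix_iff :
    IsPaired (blockMatrix NE Λ Ω NE') ↔
      (∃ lam : ℝ, ∀ X : Sec m F E, NE X + transpose (pairing m F E) NE' X = lam • X) ∧
      IsSkew (pairing m F E) Ω ∧ IsSkew (pairing m F E).flip Λ := by
  have hN : ∀ a : DoubleSec m F E,
      blockMatrix NE Λ Ω NE' a = (NE a.1 + Λ a.2, Ω a.1 + NE' a.2) := fun _ => rfl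
  simp only [IsPaired, doublePairing, hN]
  constructor
  · rintro ⟨lam, h⟩
    refine ⟨⟨lam, fun X => eq_of_pairing_eq (pairing m F E).flip fun η => ?_⟩, fun X Y => ?_,
      fun ξ η => ?_⟩
    · have := h (X, 0) (0, η)
      simp only [LinearMap.map_zero, add_zero, zero_add, LinearMap.zero_apply] at this
      rw [LinearMap.flip_apply, LinearMap.flip_apply, map_add, LinearMap.add_apply,
        pairing_transpose, pairing_real_smul, this]
    · have := h (X, 0) (Y, 0)
      simp only [LinearMap.map_zero, add_zero, zero_add, smul_zero] at this
      exact eq_neg_of_add_eq_zero_left this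
    · have := h (0, ξ) (0, η)
      simp only [LinearMap.map_zero, add_zero, zero_add, LinearMap.zero_apply, smul_zero] at this
      exact eq_neg_of_add_eq_zero_left this
  · rintro ⟨⟨lam, h⟩, hΩ, hΛ⟩
    have h' : ∀ X η, pairing m F E (NE X) η + pairing m F E X (NE' η) =
        lam • pairing m F E X η := fun X η => by
      rw [← pairing_transpose, ← LinearMap.add_apply, ← map_add, h, pairing_real_smul]
    refine ⟨lam, fun a b => ?_⟩
    have h1 := hΩ a.1 b.1
    have h2 : pairing m F E (Λ a.2) b.2 = -pairing m F E (Λ b.2) a.2 := hΛ a.2 b.2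
    rw [smul_add, ← h' a.1 b.2, ← h' b.1 a.2]
    simp only [map_add, LinearMap.add_apply]
    rw [h1, h2]
    abel

theorem swap_courant (a b : DoubleSec m F E) :
    (D.courant a b).swap = crossedProduct D.dual D.base (pairing m F E).flip a.swap b.swap := rfl

omit [T2Space M] [IsManifold (𝓡 m) ∞ M] [FiniteDimensional ℝ F]
  [ContMDiffVectorBundle ∞ F E (𝓡 m)] in
theorem swap_blockMatrix (a : DoubleSec m F E) :
    (blockMatrix NE Λ Ω NE' a).swap = blockMap NE' Ω Λ NE a.swap :=
  Prod.ext (add_comm _ _) (add_comm _ _)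

end Bialgebroid

end LieBialg
end

open LieBialg in
theorem theorem9 {m : ℕ} {M : Type*} [TopologicalSpace M] [T2Space M]
    [ChartedSpace (EuclideanSpace ℝ (Fin m)) M] [IsManifold (𝓡 m) ∞ M]
    {F : Type*} [NormedAddCommGroup F] [NormedSpace ℝ F] [FiniteDimensional ℝ F]
    {E : M → Type*} [TopologicalSpace (TotalSpace F E)] [∀ x, TopologicalSpace (E x)]
    [∀ x, AddCommGroup (E x)] [∀ x, Module ℝ (E x)] [FiberBundle F E] [VectorBundle ℝ F E]
    [ContMDiffVectorBundle ∞ F E (𝓡 m)]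
    (D : LieBialgebroid m F E)
    (NE : Sec m F E →ₗ[Fun m M] Sec m F E)
    (Λ : DualSec m F E →ₗ[Fun m M] Sec m F E)
    (Ω : Sec m F E →ₗ[Fun m M] DualSec m F E)
    (NE' : DualSec m F E →ₗ[Fun m M] DualSec m F E) :
    D.IsNijenhuis (blockMatrix NE Λ Ω NE') ↔
      (∃ lam : ℝ, ∀ X : Sec m F E, NE X + transpose (pairing m F E) NE' X = lam • X) ∧
      (IsSkew (pairing m F E) Ω ∧ IsSkew (pairing m F E).flip Λ ∧
        (∀ X Y Z, D.base.dTwo (pairing m F E) Ω X Y Z = 0) ∧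
        (∀ η ξ ζ, D.dual.dTwo (pairing m F E).flip Λ η ξ ζ = 0)) ∧
      ((∀ X Y, torsion (fun X Y => D.base.bracket X Y) NE X Y
          + contract (D.dual.bracketOf (pairing m F E) Ω) NE X Y
          - D.dual.bracketOf (pairing m F E) (Ω ∘ₗ NE) X Y = 0) ∧
        (∀ X Y, D.dual.bracket (Ω X) (Ω Y) - Ω (D.dual.bracketOf (pairing m F E) Ω X Y)
          - D.base.dMap (pairing m F E) (Ω ∘ₗ NE) X Y = 0) ∧
        (∀ η ξ, torsion (fun η ξ => D.dual.bracket η ξ) NE' η ξ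
          + contract (D.base.bracketOf (pairing m F E).flip Λ) NE' η ξ
          - D.base.bracketOf (pairing m F E).flip (Λ ∘ₗ NE') η ξ = 0) ∧
        (∀ η ξ, D.base.bracket (Λ η) (Λ ξ) - Λ (D.base.bracketOf (pairing m F E).flip Λ η ξ)
          - D.dual.dMap (pairing m F E).flip (Λ ∘ₗ NE') η ξ = 0)) := by
  have hE := isOuterNijenhuis_crossedProduct_iff D.base D.dual (pairing m F E) NE Λ Ω NE'
  have hE' := isOuterNijenhuis_crossedProduct_iff D.dual D.base (pairing m F E).flip NE' Ω Λ NE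
  -- The exchange `X + ξ ↦ ξ + X` reduces the condition on `E*` to that on the first summand.
  have hswap : IsOuterNijenhuis D.courant (blockMatrix NE Λ Ω NE') {a | a.1 = 0} ↔ _ :=
    (isOuterNijenhuis_congr (AddEquiv.prodComm) (swap_courant D) (swap_blockMatrix NE Λ Ω NE')
      fun _ => Iff.rfl).trans hE'
  rw [LieBialgebroid.IsNijenhuis, isPaired_blockMatrix_iff, hswap]
  rw [show D.courant = crossedProduct D.base D.dual (pairing m F E) from rfl,
    show blockMatrix NE Λ Ω NE' = blockMap NE Λ Ω NE' from rfl, hE]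
  constructor
  · rintro ⟨⟨hN, hΩ, hΛ⟩, ⟨hdΩ, h1, h2⟩, hdΛ, h3, h4⟩
    exact ⟨hN, ⟨hΩ, hΛ, (D.base.dMap_eq_zero_iff_dTwo _ hΩ).1 hdΩ,
      (D.dual.dMap_eq_zero_iff_dTwo _ hΛ).1 hdΛ⟩, h1, h2, h3, h4⟩
  · rintro ⟨hN, ⟨hΩ, hΛ, hdΩ, hdΛ⟩, h1, h2, h3, h4⟩
    exact ⟨⟨hN, hΩ, hΛ⟩, ⟨(D.base.dMap_eq_zero_iff_dTwo _ hΩ).2 hdΩ, h1, h2⟩,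
      (D.dual.dMap_eq_zero_iff_dTwo _ hΛ).2 hdΛ, h3, h4⟩
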